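/- \textbf{Setting.} For $j\ge 0$ let $\Lambda_j=[-j,j]^3$, and consider the unit edges and unit squares (faces) of $\mathbb{Z}^3$ contained in it. A $1$-form assigns a real number $\theta(e)$ to each oriented edge, with $\theta(e^{-1})=-\theta(e)$, and $\mathrm{d}\theta(f)=\sum_{e\in f}\theta(e)$ is the sum over the oriented boundary of the face $f$. For $\beta>0$, the Villain $U(1)$ lattice gauge theory in $\Lambda_j$ with free boundary conditions is the probability measure on angles $\theta(e)\in[-\pi,\pi)$, $e$ a positively oriented edge of $\Lambda_j$, proportional to $$\prod_{f}\ \sum_{m\in\mathbb{Z}}\exp\Big(-\frac{\beta}{2}\big(2\pi m+\mathrm{d}\theta(f)\big)^2\Big)\,\prod_e d\theta(e),$$ the first product being over the (positively oriented) faces $f$ of $\Lambda_j$. With Dirichlet boundary conditions, $\theta(e)=0$ on all edges contained in the boundary of the cube $[-j,j]^3$, and the products run over the edges and faces of $\Lambda_j$ not contained in that boundary. An infinite-volume limit at inverse temperature $\beta$, with the given boundary conditions, is a probability measure on $1$-forms on $\mathbb{Z}^3$ that is the limit in law (convergence of finite-dimensional marginals) of these measures along some subsequence of the boxes $\Lambda_j$;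 write $\langle\cdot\rangle$ for its expectation. For a rectangle with positive integer side-lengths and corners in $\mathbb{Z}^3$, lying in a plane parallel to two coordinate axes, with oriented boundary loop $\gamma$, put $W_\gamma=\prod_{e\in\gamma}e^{i\theta(e)}$. \textbf{Statement.} There is a constant $C>0$ such that for every $\beta>0$, every infinite-volume limit $\langle\cdot\rangle$ at inverse temperature $\beta$ with either free or Dirichlet boundary conditions, and every such rectangular loop $\gamma$ with side-lengths $H\le L$, $$|\langle W_\gamma\rangle|\ \le\ \exp\Big(-\frac{C}{2\beta}\,L\log H\Big).$$ -/

import Mathlib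

open MeasureTheory Filter Topology
open scoped ENNReal

namespace VillainU1

/-- Vertices of the cubic lattice in three dimensions. -/
abbrev Site : Type := Fin 3 → ℤ

/-- The lattice basis vector in direction `i`. -/
def unitVec (i : Fin 3) : Site := Pi.single i 1

/-- A positively oriented edge: `(x, i)` is the edge from `x` to `x + unitVec i`.
A one-form is identified with its values on positively oriented edges; on the reversed edge it
takes the opposite value. -/
abbrev Edge : Type := Site × Fin 3

/-- `(x, i, k)` with `i < k` is the positively oriented unit square based at `x` and spanned by
the directions `i` and `k`. -/
abbrev Face : Type := Site × Fin 3 × Fin 3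

/-- Real-valued one-forms on the lattice. -/
abbrev OneForm : Type := Edge → ℝ

/-- Discrete exterior derivative of a one-form, on the positively oriented face `f`. -/
def faceDeriv (θ : OneForm) (f : Face) : ℝ :=
  θ (f.1, f.2.1) + θ (f.1 + unitVec f.2.1, f.2.2)
    - θ (f.1 + unitVec f.2.2, f.2.1) - θ (f.1, f.2.2)

/-- The two boundary conditions. -/
inductive BoundaryCondition : Type
  | free
  | dirichlet

/-- The unit cell based at `x` and spanned by the directions in `S` is contained in `[-j, j]^3`. -/
def CellInBox (j : ℕ) (x : Site) (S : Finset (Fin 3)) : Prop :=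
  ∀ k, -(j : ℤ) ≤ x k ∧ x k + (if k ∈ S then 1 else 0) ≤ j

/-- The unit cell based at `x` and spanned by the directions in `S` (assumed to lie in the cube
`[-j, j]^3`) is contained in the boundary of this cube. -/
def CellOnBoundary (j : ℕ) (x : Site) (S : Finset (Fin 3)) : Prop :=
  ∃ k, k ∉ S ∧ |x k| = (j : ℤ)

/-- The cells of the box on which the forms of the model are allowed to be nonzero: all cells of
the box for free boundary conditions, and the cells not contained in the boundary for Dirichlet
(zero) boundary conditions. -/
def CellActive : BoundaryCondition → ℕ → Site → Finset (Fin 3) → Prop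
  | .free, j, x, S => CellInBox j x S
  | .dirichlet, j, x, S => CellInBox j x S ∧ ¬ CellOnBoundary j x S

/-- The vertices of the box `[-j, j]^3`. -/
noncomputable def boxSites (j : ℕ) : Finset Site :=
  Fintype.piFinset fun _ => Finset.Icc (-(j : ℤ)) j

open Classical in
/-- The edges of the box that carry a random angle. -/
noncomputable def activeEdges (bc : BoundaryCondition) (j : ℕ) : Finset Edge :=
  (boxSites j ×ˢ Finset.univ).filter fun e => CellActive bc j e.1 {e.2}

open Classical in
/-- The faces of the box that carry an interaction. (For Dirichlet boundary conditions the forms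
vanish on the faces contained in the boundary, which contribute nothing.) -/
noncomputable def activeFaces (bc : BoundaryCondition) (j : ℕ) : Finset Face :=
  (boxSites j ×ˢ Finset.univ).filter fun f =>
    f.2.1 < f.2.2 ∧ CellActive bc j f.1 {f.2.1, f.2.2}

/-- Extension by zero of a function on the active edges to the whole lattice. -/
noncomputable def extendByZero (bc : BoundaryCondition) (j : ℕ) (θ : activeEdges bc j → ℝ) :
    OneForm :=
  open Classical in fun e => if h : e ∈ activeEdges bc j then θ ⟨e, h⟩ else 0

/-- The Villain interaction of one face at inverse temperature `β`, as a function of the value `a`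
of the exterior derivative on that face. -/
noncomputable def faceWeight (β a : ℝ) : ℝ≥0∞ :=
  ∑' m : ℤ, ENNReal.ofReal (Real.exp (-(β / 2) * (2 * Real.pi * m + a) ^ 2))

/-- The Villain Gibbs weight in the box. -/
noncomputable def gibbsWeight (β : ℝ) (bc : BoundaryCondition) (j : ℕ) (θ : OneForm) : ℝ≥0∞ :=
  ∏ f ∈ activeFaces bc j, faceWeight β (faceDeriv θ f)

/-- The set `[-π, π)^E` of angle configurations, `E` being the set of active edges. -/
def angleCube (bc : BoundaryCondition) (j : ℕ) : Set (activeEdges bc j → ℝ) :=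
  Set.univ.pi fun _ => Set.Ico (-Real.pi) Real.pi

/-- The Gibbs measure in the box before normalization: Lebesgue measure on `[-π, π)^E` with the
Gibbs weight as density. -/
noncomputable def unnormalizedLaw (β : ℝ) (bc : BoundaryCondition) (j : ℕ) :
    Measure (activeEdges bc j → ℝ) :=
  (volume.restrict (angleCube bc j)).withDensity fun θ => gibbsWeight β bc j (extendByZero bc j θ)

/-- The partition function. -/
noncomputable def partitionFunction (β : ℝ) (bc : BoundaryCondition) (j : ℕ) : ℝ≥0∞ :=
  unnormalizedLaw β bc j Set.univ

theorem measurable_extendByZero (bc : BoundaryCondition) (j : ℕ) :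
    Measurable (extendByZero bc j) := by
  refine measurable_pi_lambda _ fun e => ?_
  by_cases h : e ∈ activeEdges bc j
  · simpa [extendByZero, h] using measurable_pi_apply _
  · simp [extendByZero, h]

theorem measurable_gibbsWeight (β : ℝ) (bc : BoundaryCondition) (j : ℕ) :
    Measurable (gibbsWeight β bc j) := by
  unfold gibbsWeight faceWeight faceDeriv
  refine Finset.measurable_prod _ fun f _ => Measurable.tsum fun m => ?_
  fun_prop

theorem faceWeight_pos (β a : ℝ) : 0 < faceWeight β a := by
  refine lt_of_lt_of_le ?_ (ENNReal.le_tsum (0 : ℤ))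
  exact ENNReal.ofReal_pos.2 (Real.exp_pos _)

theorem summable_gaussian (c : ℝ) (hc : 0 < c) :
    Summable fun m : ℤ => Real.exp (-c * (m : ℝ) ^ 2) := by
  have h := summable_pow_mul_jacobiTheta₂_term_bound 0 (T := c / Real.pi) (by positivity) 0
  refine h.congr fun m => ?_
  have hp : Real.pi ≠ 0 := Real.pi_ne_zero
  rw [pow_zero, one_mul]
  congr 1
  field_simp
  ring

theorem faceWeight_le (β : ℝ) (hβ : 0 < β) :
    ∃ K : ℝ≥0∞, K ≠ ∞ ∧ ∀ a : ℝ, |a| ≤ 4 * Real.pi → faceWeight β a ≤ K := by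
  have hs : Summable fun m : ℤ => Real.exp (β / 2 * (4 * Real.pi) ^ 2) *
      Real.exp (-(β * Real.pi ^ 2) * (m : ℝ) ^ 2) :=
    (summable_gaussian _ (by positivity)).mul_left _
  refine ⟨∑' m : ℤ, ENNReal.ofReal (Real.exp (β / 2 * (4 * Real.pi) ^ 2) *
      Real.exp (-(β * Real.pi ^ 2) * (m : ℝ) ^ 2)), ?_, fun a ha => ?_⟩
  · rw [← ENNReal.ofReal_tsum_of_nonneg (fun m => by positivity) hs]
    exact ENNReal.ofReal_ne_top
  · refine ENNReal.tsum_le_tsum fun m => ENNReal.ofReal_le_ofReal ?_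
    rw [← Real.exp_add]
    refine Real.exp_le_exp.2 ?_
    have h1 : a ^ 2 ≤ (4 * Real.pi) ^ 2 := sq_le_sq' (abs_le.1 ha).1 (abs_le.1 ha).2
    have h2 : 0 ≤ (Real.pi * m + a) ^ 2 * (β) := by positivity
    nlinarith [mul_le_mul_of_nonneg_left h1 hβ.le]

theorem partitionFunction_ne_top (β : ℝ) (hβ : 0 < β) (bc : BoundaryCondition) (j : ℕ) :
    partitionFunction β bc j ≠ ∞ := by
  obtain ⟨K, hK, hle⟩ := faceWeight_le β hβ
  have hmeas : MeasurableSet (angleCube bc j) :=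
    MeasurableSet.univ_pi fun _ => measurableSet_Ico
  rw [partitionFunction, unnormalizedLaw, withDensity_apply _ MeasurableSet.univ,
    Measure.restrict_univ]
  refine ne_top_of_le_ne_top (b := ∫⁻ _ in angleCube bc j, K ^ (activeFaces bc j).card) ?_ ?_
  · rw [setLIntegral_const]
    refine ENNReal.mul_ne_top (ENNReal.pow_ne_top hK) ?_
    rw [angleCube, volume_pi_pi]
    exact ENNReal.prod_ne_top fun _ _ => by simp [Real.volume_Ico]
  · refine setLIntegral_mono' hmeas fun θ hθ => ?_
    have hb : ∀ e, |extendByZero bc j θ e| ≤ Real.pi := fun e => by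
      by_cases h : e ∈ activeEdges bc j
      · have := hθ ⟨e, h⟩ (Set.mem_univ _)
        simpa [extendByZero, h] using abs_le.2 ⟨this.1, this.2.le⟩
      · simp [extendByZero, h, Real.pi_pos.le]
    refine Finset.prod_le_pow_card _ _ _ fun f _ => hle _ ?_
    have h1 := abs_le.1 (hb (f.1, f.2.1))
    have h2 := abs_le.1 (hb (f.1 + unitVec f.2.1, f.2.2))
    have h3 := abs_le.1 (hb (f.1 + unitVec f.2.2, f.2.1))
    have h4 := abs_le.1 (hb (f.1, f.2.2))
    rw [faceDeriv, abs_le]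
    constructor <;> linarith

theorem partitionFunction_ne_zero (β : ℝ) (bc : BoundaryCondition) (j : ℕ) :
    partitionFunction β bc j ≠ 0 := by
  rw [partitionFunction, unnormalizedLaw, withDensity_apply _ MeasurableSet.univ,
    Measure.restrict_univ]
  have hm : Measurable fun θ => gibbsWeight β bc j (extendByZero bc j θ) :=
    (measurable_gibbsWeight β bc j).comp (measurable_extendByZero bc j)
  have hpos : ∀ θ, gibbsWeight β bc j (extendByZero bc j θ) ≠ 0 := fun θ =>
    Finset.prod_ne_zero_iff.2 fun f _ => (faceWeight_pos _ _).ne'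
  rw [← pos_iff_ne_zero, lintegral_pos_iff_support hm]
  have hsupp : (Function.support fun θ => gibbsWeight β bc j (extendByZero bc j θ)) = Set.univ :=
    Set.eq_univ_of_forall hpos
  rw [hsupp, Measure.restrict_apply_univ, angleCube, volume_pi_pi, pos_iff_ne_zero]
  refine Finset.prod_ne_zero_iff.2 fun _ _ => ?_
  rw [Real.volume_Ico]
  exact (ENNReal.ofReal_pos.2 (by linarith [Real.pi_pos])).ne'

/-- The law of the Villain lattice gauge theory in the box `[-j, j]^3`, as a law on one-forms of
the whole lattice that vanish off the active edges. -/
noncomputable def villainLaw (β : ℝ) (hβ : 0 < β) (bc : BoundaryCondition) (j : ℕ) :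
    ProbabilityMeasure OneForm :=
  ⟨((partitionFunction β bc j)⁻¹ • unnormalizedLaw β bc j).map (extendByZero bc j), by
    have : IsProbabilityMeasure ((partitionFunction β bc j)⁻¹ • unnormalizedLaw β bc j) := ⟨by
      rw [Measure.smul_apply, smul_eq_mul]
      exact ENNReal.inv_mul_cancel (partitionFunction_ne_zero β bc j)
        (partitionFunction_ne_top β hβ bc j)⟩
    exact Measure.isProbabilityMeasure_map (measurable_extendByZero bc j).aemeasurable⟩

/-- `P` is an infinite-volume limit at inverse temperature `β`: along some subsequence of boxes, the
finite-volume laws converge to `P` in law (for the product topology on one-forms, that is, in the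
sense of finite-dimensional marginals). -/
def IsInfiniteVolumeLimit (β : ℝ) (hβ : 0 < β) (bc : BoundaryCondition)
    (P : ProbabilityMeasure OneForm) : Prop :=
  ∃ φ : ℕ → ℕ, StrictMono φ ∧
    Tendsto (fun n => villainLaw β hβ bc (φ n)) atTop (𝓝 P)

/-- A rectangular loop in a plane parallel to two coordinate axes. It starts at the corner `base`
and runs `len₁` steps along `dir₁`, `len₂` steps along `dir₂`, then back along `dir₁` and back
along `dir₂`. (Exchanging the two directions and lengths reverses the orientation.) -/
structure RectangularLoop where
  base : Site
  dir₁ : Fin 3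
  dir₂ : Fin 3
  dir_ne : dir₁ ≠ dir₂
  len₁ : ℕ
  len₂ : ℕ
  len₁_pos : 0 < len₁
  len₂_pos : 0 < len₂

namespace RectangularLoop

/-- The shorter side-length. -/
def shortSide (γ : RectangularLoop) : ℕ := min γ.len₁ γ.len₂

/-- The longer side-length. -/
def longSide (γ : RectangularLoop) : ℕ := max γ.len₁ γ.len₂

/-- The Wilson loop observable: the product of `exp (i θ(e))` over the oriented edges `e` of the
loop, where a reversed edge contributes `exp (-i θ(e))`. -/
noncomputable def wilson (γ : RectangularLoop) (θ : OneForm) : ℂ :=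
  (∏ s ∈ Finset.range γ.len₁,
      Complex.exp (Complex.I * θ (γ.base + s • unitVec γ.dir₁, γ.dir₁))) *
    (∏ t ∈ Finset.range γ.len₂,
      Complex.exp (Complex.I *
        θ (γ.base + γ.len₁ • unitVec γ.dir₁ + t • unitVec γ.dir₂, γ.dir₂))) *
    (∏ s ∈ Finset.range γ.len₁,
      Complex.exp (-(Complex.I *
        θ (γ.base + γ.len₂ • unitVec γ.dir₂ + s • unitVec γ.dir₁, γ.dir₁)))) *
    (∏ t ∈ Finset.range γ.len₂,
      Complex.exp (-(Complex.I * θ (γ.base + t • unitVec γ.dir₂, γ.dir₂))))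

end RectangularLoop

end VillainU1

/-! The argument is a complex translation of McBryan–Spencer type. The integrand in the numerator of
`⟨W_γ⟩` is entire and `2π`-periodic in every angle, so `θ` may be replaced by `θ + i b` for any real
one-form `b` on the active edges (`setIntegral_pi_Ico_add_I_mul`). The Wilson loop then gains the
factor `exp(-∮_γ b)`. Each face weight is a sum of Gaussians, and its modulus grows by at most
`exp(β/2 (db)²)`, uniformly in the winding number `m` (`norm_villainEntire_le`). Hence `|⟨W_γ⟩| ≤
exp(-∮_γ b + β/2 ‖db‖²)` in finite volume (`norm_integral_wilson_villainLaw_le`).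

It remains to choose `b`: a multiple of `wireForm`, carried by edges parallel to a long side of the
loop and decaying logarithmically with the transverse distance, down to zero at distance `H`. With
`h` the `H`-th harmonic number, its circulation is `± L h`, and its energy is at most `81 L h`
because a logarithm has Dirichlet energy of order `log H` in two dimensions. Optimising the multiple
gives the exponent `-L h / (162 β)`, and `h ≥ log H`. The bound holds in every large box, hence in
the limit. -/

namespace VillainU1

/-! ### Contour shift for periodic functions of several angles. -/

/-- The box `∏ [a i, a i + T)` is a fundamental domain for the translations by `T ℤ^ι`. -/
theorem isAddFundamentalDomain_pi_Ico {ι : Type*} [Fintype ι] {T : ℝ} (hT : 0 < T) (a : ι → ℝ) :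
    IsAddFundamentalDomain ((AddMonoidHom.compLeft
      ((AddMonoidHom.mulLeft T).comp (Int.castAddHom ℝ)) ι).range)
      (Set.univ.pi fun i => Set.Ico (a i) (a i + T)) := by
  refine IsAddFundamentalDomain.mk'
    (MeasurableSet.univ_pi fun _ => measurableSet_Ico).nullMeasurableSet fun x => ?_
  have key : ∀ i, ∃! m : ℤ, x i + m • T ∈ Set.Ico (a i) (a i + T) := fun i =>
    existsUnique_add_zsmul_mem_Ico hT (x i) (a i)
  choose m hm hu using key
  refine ⟨⟨_, ⟨m, rfl⟩⟩, fun i _ => ?_, ?_⟩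
  · have := hm i
    simpa [AddSubgroup.vadd_def, mul_comm, add_comm] using this
  · rintro ⟨_, ⟨n, rfl⟩⟩ hn
    have : n = m := funext fun i => hu i _ <| by
      have := hn i (Set.mem_univ _)
      simpa [AddSubgroup.vadd_def, mul_comm, add_comm] using this
    subst this
    rfl

/-- The integral over a period of a function periodic in every variable is invariant under
translations. -/
theorem setIntegral_pi_Ico_add {ι : Type*} [Fintype ι] {f : (ι → ℝ) → ℂ}
    (hf : ∀ (n : ι → ℤ) x, f (fun i => x i + 2 * Real.pi * n i) = f x) (v : ι → ℝ) :
    ∫ x in Set.univ.pi fun _ => Set.Ico (-Real.pi) Real.pi, f (x + v) =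
      ∫ x in Set.univ.pi fun _ => Set.Ico (-Real.pi) Real.pi, f x := by
  have h2 : (fun _ : ι => Set.Ico (-Real.pi) Real.pi) =
      fun _ => Set.Ico (-Real.pi) (-Real.pi + 2 * Real.pi) := by
    funext; congr 1; ring
  have hpre : (Set.univ.pi fun _ : ι => Set.Ico (-Real.pi) Real.pi) =
      (· + v) ⁻¹' (Set.univ.pi fun i => Set.Ico (-Real.pi + v i) (-Real.pi + v i + 2 * Real.pi)) := by
    ext x
    simp only [Set.mem_pi, Set.mem_univ, true_implies, Set.mem_Ico, Set.mem_preimage, Pi.add_apply]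
    refine forall_congr' fun i => ?_
    constructor <;> rintro ⟨h, h'⟩ <;> constructor <;> linarith
  have hinv : ∀ (g : (AddMonoidHom.compLeft
      ((AddMonoidHom.mulLeft (2 * Real.pi)).comp (Int.castAddHom ℝ)) ι).range) (x : ι → ℝ),
      f (g +ᵥ x) = f x := by
    rintro ⟨_, ⟨n, rfl⟩⟩ x
    rw [← hf n x]
    congr 1
    funext i
    simp [AddSubgroup.vadd_def, add_comm]
  conv_lhs => rw [hpre]
  rw [(measurePreserving_add_right volume v).setIntegral_preimage_emb
    (MeasurableEquiv.addRight v).measurableEmbedding f, h2]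
  have : Countable (AddMonoidHom.compLeft
      ((AddMonoidHom.mulLeft (2 * Real.pi)).comp (Int.castAddHom ℝ)) ι).range :=
    (AddMonoidHom.rangeRestrict_surjective _).countable
  -- The cube and its translate are both fundamental domains for `2πℤ^ι`, under which `f` is
  -- invariant.
  exact IsAddFundamentalDomain.setIntegral_eq
    (isAddFundamentalDomain_pi_Ico Real.two_pi_pos _)
    (isAddFundamentalDomain_pi_Ico Real.two_pi_pos _) hinv

/-- Contour shift on a torus: translating a periodic holomorphic function in an imaginary direction
does not change its integral over the real torus. -/
theorem setIntegral_pi_Ico_add_I_mul {ι : Type*} [Fintype ι] {g : (ι → ℂ) → ℂ}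
    (hg : ContDiff ℂ 1 g)
    (hp : ∀ (n : ι → ℤ) ζ, g (fun i => ζ i + 2 * Real.pi * n i) = g ζ) (v : ι → ℝ) :
    ∫ x : ι → ℝ in Set.univ.pi fun _ => Set.Ico (-Real.pi) Real.pi,
        g (fun i => x i + Complex.I * v i) =
      ∫ x : ι → ℝ in Set.univ.pi fun _ => Set.Ico (-Real.pi) Real.pi, g (fun i => x i) := by
  set Q : Set (ι → ℝ) := Set.univ.pi fun _ => Set.Ico (-Real.pi) Real.pi with hQ
  set K : Set (ι → ℝ) := Set.univ.pi fun _ => Set.Icc (-Real.pi) Real.pi with hK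
  have hQK : Q ⊆ K := Set.pi_mono fun _ _ => Set.Ico_subset_Icc_self
  have hKc : IsCompact K := isCompact_univ_pi fun _ => isCompact_Icc
  have hQm : MeasurableSet Q := MeasurableSet.univ_pi fun _ => measurableSet_Ico
  have hQfin : volume Q ≠ ∞ := (lt_of_le_of_lt (measure_mono hQK) hKc.measure_lt_top).ne
  let p : ℂ → (ι → ℝ) → ι → ℂ := fun z x i => x i + z * v i
  have hpc : Continuous fun q : ℂ × (ι → ℝ) => p q.1 q.2 := by
    refine continuous_pi fun i => ?_
    simp only [p]
    fun_prop
  have hgc : Continuous g := hg.continuous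
  have hg'c : Continuous fun ζ => fderiv ℂ g ζ (fun i => (v i : ℂ)) :=
    (hg.continuous_fderiv one_ne_zero).clm_apply continuous_const
  have hgp : ∀ z, Continuous fun x => g (p z x) := fun z =>
    hgc.comp (hpc.comp (Continuous.prodMk_right z))
  have hint : ∀ z, IntegrableOn (fun x => g (p z x)) Q := fun z =>
    ((hgp z).continuousOn.integrableOn_compact hKc).mono_set hQK
  -- All coordinates are shifted at once along the complex line `z ↦ z v`. `F` is entire and, by
  -- real translation invariance, constant on the real axis; the identity theorem then gives `F I =
  -- F 0`.
  let F : ℂ → ℂ := fun z => ∫ x in Q, g (p z x)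
  have hF : Differentiable ℂ F := by
    intro z₀
    obtain ⟨M, hM⟩ := ((isCompact_closedBall z₀ 1).prod hKc).exists_bound_of_continuousOn
      (hg'c.comp hpc).continuousOn
    refine (hasDerivAt_integral_of_dominated_loc_of_deriv_le (μ := volume.restrict Q)
      (F := fun z x => g (p z x))
      (F' := fun z x => fderiv ℂ g (p z x) (fun i => (v i : ℂ))) (bound := fun _ => M)
      (s := Metric.closedBall z₀ 1)
      (Metric.closedBall_mem_nhds z₀ one_pos)
      (Eventually.of_forall fun z => (hgp z).aestronglyMeasurable) (hint z₀)
      (hg'c.comp (hpc.comp (Continuous.prodMk_right z₀))).aestronglyMeasurable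
      ?_ ?_ ?_).2.differentiableAt
    · refine (ae_restrict_iff' hQm).2 (Eventually.of_forall fun x hx z hz => ?_)
      exact hM (z, x) ⟨hz, hQK hx⟩
    · exact integrableOn_const hQfin
    · refine Eventually.of_forall fun x z _ => ?_
      have h1 : HasDerivAt (fun z => p z x) (fun i => (v i : ℂ)) z := by
        refine hasDerivAt_pi.2 fun i => ?_
        simpa [p] using ((hasDerivAt_id z).mul_const (v i : ℂ)).const_add (x i : ℂ)
      exact ((hg.differentiable one_ne_zero) (p z x)).hasFDerivAt.comp_hasDerivAt z h1
  have hreal : ∀ t : ℝ, F t = F 0 := by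
    intro t
    have := setIntegral_pi_Ico_add (f := fun x : ι → ℝ => g (fun i => x i))
      (fun n x => by simpa using hp n (fun i => x i)) (t • v)
    simpa [F, p, Q] using this
  have hconst : F = fun _ => F 0 := by
    have h1 : AnalyticOnNhd ℂ F Set.univ := fun z _ => hF.analyticAt z
    refine h1.eq_of_frequently_eq (z₀ := 0) (fun z _ => analyticAt_const) ?_
    have h2 : Tendsto (fun n : ℕ => (((1 / ((n : ℝ) + 1) : ℝ)) : ℂ)) atTop (𝓝[≠] 0) := by
      refine tendsto_nhdsWithin_iff.2 ⟨?_, Eventually.of_forall fun n => ?_⟩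
      · simpa [Function.comp_def] using (Complex.continuous_ofReal.tendsto 0).comp
          (tendsto_one_div_add_atTop_nhds_zero_nat (𝕜 := ℝ))
      · have : (1 / ((n : ℝ) + 1)) ≠ 0 := by positivity
        simpa only [Set.mem_compl_iff, Set.mem_singleton_iff, Complex.ofReal_eq_zero] using this
    exact h2.frequently (Frequently.of_forall fun n => hreal _)
  have := congrFun hconst Complex.I
  simpa [F, p] using this

/-! ### The Villain weight at complex arguments. -/

/-- The Villain interaction of one face, as an entire function. -/
noncomputable def villainEntire (β : ℝ) (z : ℂ) : ℂ :=
  ∑' m : ℤ, Complex.exp (-(β / 2) * (2 * Real.pi * m + z) ^ 2)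

/-- Expanding the square leaves a theta series with `τ = 2πβi` in the upper half-plane; summability
and holomorphy are inherited from `jacobiTheta₂`. -/
theorem villainEntire_term (β : ℝ) (z : ℂ) (m : ℤ) :
    Complex.exp (-(β / 2) * (2 * Real.pi * m + z) ^ 2) =
      Complex.exp (-(β / 2) * z ^ 2) *
        jacobiTheta₂_term m (Complex.I * β * z) (2 * Real.pi * β * Complex.I) := by
  rw [jacobiTheta₂_term, ← Complex.exp_add]
  congr 1
  linear_combination (-2 * Real.pi * m * β * z - 2 * Real.pi ^ 2 * m ^ 2 * β) * Complex.I_sq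

theorem im_villain_tau {β : ℝ} (hβ : 0 < β) : 0 < (2 * Real.pi * β * Complex.I : ℂ).im := by
  have : (2 * Real.pi * β * Complex.I : ℂ) = ((2 * Real.pi * β : ℝ) : ℂ) * Complex.I := by
    push_cast; ring
  rw [this, Complex.im_ofReal_mul, Complex.I_im, mul_one]
  positivity

theorem summable_villainEntire {β : ℝ} (hβ : 0 < β) (z : ℂ) :
    Summable fun m : ℤ => Complex.exp (-(β / 2) * (2 * Real.pi * m + z) ^ 2) := by
  simp_rw [villainEntire_term]
  exact (hasSum_jacobiTheta₂_term _ (im_villain_tau hβ)).summable.mul_left _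

theorem contDiff_villainEntire {β : ℝ} (hβ : 0 < β) : ContDiff ℂ 1 (villainEntire β) := by
  have h : villainEntire β = fun z => Complex.exp (-(β / 2) * z ^ 2) *
      jacobiTheta₂ (Complex.I * β * z) (2 * Real.pi * β * Complex.I) := by
    funext z
    simp_rw [villainEntire, villainEntire_term, tsum_mul_left, jacobiTheta₂]
  rw [h]
  refine Differentiable.contDiff fun z => ?_
  refine DifferentiableAt.mul (by fun_prop) ?_
  exact (differentiableAt_jacobiTheta₂_fst (Complex.I * β * z) (im_villain_tau hβ)).comp z
    (f := fun z : ℂ => Complex.I * β * z) (by fun_prop)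

theorem villainEntire_add_two_pi (β : ℝ) (z : ℂ) (n : ℤ) :
    villainEntire β (z + 2 * Real.pi * n) = villainEntire β z := by
  unfold villainEntire
  rw [← (Equiv.addRight n).tsum_eq
    (fun m : ℤ => Complex.exp (-(β / 2) * (2 * Real.pi * m + z) ^ 2))]
  refine tsum_congr fun m => ?_
  simp only [Equiv.coe_addRight]
  push_cast
  ring_nf

/-- The cross term in the square is a pure phase, so the cost `exp(β y²/2)` of the imaginary shift
does not depend on `m`. This is what allows a termwise bound of the series. -/
theorem norm_villain_term (β x y : ℝ) (m : ℤ) :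
    ‖Complex.exp (-(β / 2) * (2 * Real.pi * m + (x + Complex.I * y)) ^ 2)‖ =
      Real.exp (β / 2 * y ^ 2) * Real.exp (-(β / 2) * (2 * Real.pi * m + x) ^ 2) := by
  rw [Complex.norm_exp, ← Real.exp_add]
  congr 1
  have : (-(β / 2) * (2 * Real.pi * m + (x + Complex.I * y)) ^ 2 : ℂ) =
      ((β / 2 * y ^ 2 + -(β / 2) * (2 * Real.pi * m + x) ^ 2 : ℝ) : ℂ) +
        ((-(β * (2 * Real.pi * m + x) * y) : ℝ) : ℂ) * Complex.I := by
    push_cast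
    linear_combination (-(β / 2) * y ^ 2 : ℂ) * Complex.I_sq
  rw [this, Complex.add_re, Complex.ofReal_re, Complex.re_ofReal_mul, Complex.I_re, mul_zero,
    add_zero]

theorem summable_villain {β : ℝ} (hβ : 0 < β) (x : ℝ) :
    Summable fun m : ℤ => Real.exp (-(β / 2) * (2 * Real.pi * m + x) ^ 2) := by
  have h := (summable_villainEntire hβ (x + Complex.I * (0 : ℝ))).norm
  simp_rw [norm_villain_term] at h
  simpa using h

theorem toReal_faceWeight {β : ℝ} (hβ : 0 < β) (x : ℝ) :
    (faceWeight β x).toReal = ∑' m : ℤ, Real.exp (-(β / 2) * (2 * Real.pi * m + x) ^ 2) := by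
  rw [faceWeight, ← ENNReal.ofReal_tsum_of_nonneg (fun _ => (Real.exp_pos _).le)
    (summable_villain hβ x), ENNReal.toReal_ofReal (tsum_nonneg fun _ => (Real.exp_pos _).le)]

theorem villainEntire_ofReal {β : ℝ} (hβ : 0 < β) (x : ℝ) :
    villainEntire β x = ((faceWeight β x).toReal : ℂ) := by
  rw [toReal_faceWeight hβ, villainEntire, Complex.ofReal_tsum]
  push_cast
  rfl

theorem norm_villainEntire_le {β : ℝ} (hβ : 0 < β) (x y : ℝ) :
    ‖villainEntire β (x + Complex.I * y)‖ ≤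
      Real.exp (β / 2 * y ^ 2) * (faceWeight β x).toReal := by
  rw [toReal_faceWeight hβ, ← tsum_mul_left]
  simp_rw [← norm_villain_term]
  exact norm_tsum_le_tsum_norm (summable_villainEntire hβ _).norm

/-! ### Forms with coefficients in a ring. -/

/-- `faceDeriv` for one-forms with values in a ring. -/
def curl {R : Type*} [CommRing R] (Θ : Edge → R) (f : Face) : R :=
  Θ (f.1, f.2.1) + Θ (f.1 + unitVec f.2.1, f.2.2)
    - Θ (f.1 + unitVec f.2.2, f.2.1) - Θ (f.1, f.2.2)

/-- The circulation of a one-form along a rectangular loop. -/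
def RectangularLoop.circulation {R : Type*} [CommRing R] (γ : RectangularLoop) (Θ : Edge → R) : R :=
  (∑ s ∈ Finset.range γ.len₁, Θ (γ.base + s • unitVec γ.dir₁, γ.dir₁)) +
    (∑ t ∈ Finset.range γ.len₂,
      Θ (γ.base + γ.len₁ • unitVec γ.dir₁ + t • unitVec γ.dir₂, γ.dir₂)) -
    (∑ s ∈ Finset.range γ.len₁, Θ (γ.base + γ.len₂ • unitVec γ.dir₂ + s • unitVec γ.dir₁, γ.dir₁)) -
    (∑ t ∈ Finset.range γ.len₂, Θ (γ.base + t • unitVec γ.dir₂, γ.dir₂))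

section

variable {R S : Type*} [CommRing R] [CommRing S]

theorem curl_add_mul (Θ Φ : Edge → R) (c : R) (f : Face) :
    curl (fun e => Θ e + c * Φ e) f = curl Θ f + c * curl Φ f := by
  unfold curl; ring

/-- Used for `ℤ → ℂ`, to get periodicity, and for `ℝ → ℂ`, to separate real and imaginary parts. -/
theorem curl_map (φ : R →+* S) (Θ : Edge → R) (f : Face) :
    curl (fun e => φ (Θ e)) f = φ (curl Θ f) := by
  simp [curl]

theorem circulation_add_mul (γ : RectangularLoop) (Θ Φ : Edge → R) (c : R) :
    γ.circulation (fun e => Θ e + c * Φ e) = γ.circulation Θ + c * γ.circulation Φ := by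
  simp only [RectangularLoop.circulation, Finset.sum_add_distrib, ← Finset.mul_sum]
  ring

theorem circulation_map (γ : RectangularLoop) (φ : R →+* S) (Θ : Edge → R) :
    γ.circulation (fun e => φ (Θ e)) = φ (γ.circulation Θ) := by
  simp [RectangularLoop.circulation]

open Classical in
/-- Extension by zero of a ring-valued function on the active edges. -/
noncomputable def zeroExtend (bc : BoundaryCondition) (j : ℕ) (ζ : activeEdges bc j → R) :
    Edge → R :=
  fun e => if h : e ∈ activeEdges bc j then ζ ⟨e, h⟩ else 0

theorem zeroExtend_add_mul (bc : BoundaryCondition) (j : ℕ) (ζ ξ : activeEdges bc j → R) (c : R) :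
    zeroExtend bc j (fun e => ζ e + c * ξ e) =
      fun e => zeroExtend bc j ζ e + c * zeroExtend bc j ξ e := by
  funext e
  by_cases h : e ∈ activeEdges bc j <;> simp [zeroExtend, h]

theorem zeroExtend_map (bc : BoundaryCondition) (j : ℕ) (φ : R →+* S) (ζ : activeEdges bc j → R) :
    zeroExtend bc j (fun e => φ (ζ e)) = fun e => φ (zeroExtend bc j ζ e) := by
  funext e
  by_cases h : e ∈ activeEdges bc j <;> simp [zeroExtend, h]

end

theorem zeroExtend_restrict (bc : BoundaryCondition) (j : ℕ) (b : OneForm)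
    (hb : ∀ e, b e ≠ 0 → e ∈ activeEdges bc j) :
    zeroExtend bc j (fun e => b e) = b := by
  funext e
  by_cases h : e ∈ activeEdges bc j
  · simp [zeroExtend, h]
  · simpa [zeroExtend, h] using (not_imp_comm.1 (hb e) h).symm

theorem wilson_eq_exp (γ : RectangularLoop) (θ : OneForm) :
    γ.wilson θ = Complex.exp (Complex.I * (γ.circulation θ : ℝ)) := by
  simp only [RectangularLoop.wilson, RectangularLoop.circulation, ← Complex.exp_sum,
    ← Complex.exp_add]
  congr 1
  push_cast
  simp only [Finset.sum_neg_distrib, ← Finset.mul_sum]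
  ring

/-! ### The variational bound in finite volume. -/

/-- The product of the Wilson loop observable and the Gibbs weight, continued to complex angles. -/
noncomputable def wilsonGibbs (β : ℝ) (bc : BoundaryCondition) (j : ℕ) (γ : RectangularLoop)
    (ζ : activeEdges bc j → ℂ) : ℂ :=
  Complex.exp (Complex.I * γ.circulation (zeroExtend bc j ζ)) *
    ∏ f ∈ activeFaces bc j, villainEntire β (curl (zeroExtend bc j ζ) f)

theorem contDiff_wilsonGibbs {β : ℝ} (hβ : 0 < β) (bc : BoundaryCondition) (j : ℕ)
    (γ : RectangularLoop) : ContDiff ℂ 1 (wilsonGibbs β bc j γ) := by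
  have h (e : Edge) : ContDiff ℂ 1 fun ζ : activeEdges bc j → ℂ => zeroExtend bc j ζ e := by
    by_cases he : e ∈ activeEdges bc j
    · simp only [zeroExtend, he, dif_pos]
      fun_prop
    · simp only [zeroExtend, he, dif_neg, not_false_eq_true]
      fun_prop
  refine ContDiff.mul (ContDiff.cexp (contDiff_const.mul ?_))
    (contDiff_prod fun f _ => (contDiff_villainEntire hβ).comp ?_)
  · exact (((ContDiff.sum fun _ _ => h _).add (ContDiff.sum fun _ _ => h _)).sub
      (ContDiff.sum fun _ _ => h _)).sub (ContDiff.sum fun _ _ => h _)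
  · exact (((h _).add (h _)).sub (h _)).sub (h _)

/-- Curl and circulation have integer coefficients, so shifting angles by `2πℤ` shifts them by
`2πℤ`. -/
theorem wilsonGibbs_add_two_pi (β : ℝ) (bc : BoundaryCondition) (j : ℕ) (γ : RectangularLoop)
    (n : activeEdges bc j → ℤ) (ζ : activeEdges bc j → ℂ) :
    wilsonGibbs β bc j γ (fun e => ζ e + 2 * Real.pi * n e) = wilsonGibbs β bc j γ ζ := by
  have h := zeroExtend_map bc j (Int.castRingHom ℂ) n
  simp only [eq_intCast] at h
  have h1 := circulation_map γ (Int.castRingHom ℂ) (zeroExtend bc j n)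
  have h2 := curl_map (Int.castRingHom ℂ) (zeroExtend bc j n)
  simp only [eq_intCast] at h1 h2
  simp only [wilsonGibbs, zeroExtend_add_mul, h, circulation_add_mul, curl_add_mul, h1, h2,
    villainEntire_add_two_pi]
  congr 1
  rw [mul_add, Complex.exp_add, mul_eq_left₀ (Complex.exp_ne_zero _), Complex.exp_eq_one_iff]
  exact ⟨γ.circulation (zeroExtend bc j n), by ring⟩

theorem gibbsWeight_ne_top {β : ℝ} (hβ : 0 < β) (bc : BoundaryCondition) (j : ℕ) (θ : OneForm) :
    gibbsWeight β bc j θ ≠ ∞ := by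
  refine ENNReal.prod_ne_top fun f _ => ?_
  rw [faceWeight, ← ENNReal.ofReal_tsum_of_nonneg (fun _ => (Real.exp_pos _).le)
    (summable_villain hβ _)]
  exact ENNReal.ofReal_ne_top

theorem wilsonGibbs_ofReal {β : ℝ} (hβ : 0 < β) (bc : BoundaryCondition) (j : ℕ)
    (γ : RectangularLoop) (θ : activeEdges bc j → ℝ) :
    wilsonGibbs β bc j γ (fun e => θ e) =
      (gibbsWeight β bc j (extendByZero bc j θ)).toReal • γ.wilson (extendByZero bc j θ) := by
  have h := zeroExtend_map bc j Complex.ofRealHom θ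
  have h1 := circulation_map γ Complex.ofRealHom (zeroExtend bc j θ)
  have h2 := curl_map Complex.ofRealHom (zeroExtend bc j θ)
  simp only [Complex.ofRealHom_eq_coe] at h h1 h2
  simp only [wilsonGibbs, h, h1, h2, villainEntire_ofReal hβ, wilson_eq_exp, gibbsWeight,
    ENNReal.toReal_prod, Complex.real_smul, Complex.ofReal_prod]
  rw [mul_comm]
  rfl

theorem norm_wilsonGibbs_le {β : ℝ} (hβ : 0 < β) (bc : BoundaryCondition) (j : ℕ)
    (γ : RectangularLoop) (b : OneForm) (hb : ∀ e, b e ≠ 0 → e ∈ activeEdges bc j)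
    (θ : activeEdges bc j → ℝ) :
    ‖wilsonGibbs β bc j γ (fun e => θ e + Complex.I * b e)‖ ≤
      Real.exp (-γ.circulation b + β / 2 * ∑ f ∈ activeFaces bc j, faceDeriv b f ^ 2) *
        (gibbsWeight β bc j (extendByZero bc j θ)).toReal := by
  have h := zeroExtend_map bc j Complex.ofRealHom θ
  have hb' := zeroExtend_map bc j Complex.ofRealHom (fun e => b e)
  have h1 := circulation_map γ Complex.ofRealHom
  have h2 := curl_map Complex.ofRealHom
  simp only [Complex.ofRealHom_eq_coe, zeroExtend_restrict bc j b hb] at h hb' h1 h2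
  simp only [wilsonGibbs, zeroExtend_add_mul, h, hb', circulation_add_mul, curl_add_mul, h1, h2,
    norm_mul, norm_prod]
  have hre : (Complex.I * (((γ.circulation (zeroExtend bc j θ) : ℝ) : ℂ) +
      Complex.I * ((γ.circulation b : ℝ) : ℂ))).re = -γ.circulation b := by
    simp
  rw [Complex.norm_exp, hre, Real.exp_add, mul_assoc]
  refine mul_le_mul_of_nonneg_left ?_ (Real.exp_pos _).le
  rw [Finset.mul_sum, Real.exp_sum, gibbsWeight, ENNReal.toReal_prod, ← Finset.prod_mul_distrib]
  exact Finset.prod_le_prod (fun _ _ => norm_nonneg _) fun f _ => norm_villainEntire_le hβ _ _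

/-- The finite-volume Wilson loop expectation is bounded by a Gaussian variational expression. -/
theorem norm_integral_wilson_villainLaw_le {β : ℝ} (hβ : 0 < β) (bc : BoundaryCondition) (j : ℕ)
    (γ : RectangularLoop) (b : OneForm) (hb : ∀ e, b e ≠ 0 → e ∈ activeEdges bc j) :
    ‖∫ θ, γ.wilson θ ∂(villainLaw β hβ bc j : Measure OneForm)‖ ≤
      Real.exp (-γ.circulation b + β / 2 * ∑ f ∈ activeFaces bc j, faceDeriv b f ^ 2) := by
  set A := Real.exp (-γ.circulation b + β / 2 * ∑ f ∈ activeFaces bc j, faceDeriv b f ^ 2)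
  set Z := partitionFunction β bc j
  have hm : Measurable fun θ => gibbsWeight β bc j (extendByZero bc j θ) :=
    (measurable_gibbsWeight β bc j).comp (measurable_extendByZero bc j)
  have hW : Measurable γ.wilson := by
    unfold RectangularLoop.wilson
    fun_prop
  have hlt : ∀ᵐ θ ∂(volume.restrict (angleCube bc j)),
      gibbsWeight β bc j (extendByZero bc j θ) < ∞ :=
    Eventually.of_forall fun θ => (gibbsWeight_ne_top hβ bc j _).lt_top
  have hZ : Z = ∫⁻ θ in angleCube bc j, gibbsWeight β bc j (extendByZero bc j θ) := by
    simp only [Z, partitionFunction, unnormalizedLaw, withDensity_apply _ MeasurableSet.univ,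
      Measure.restrict_univ]
  have hZtop : Z ≠ ∞ := partitionFunction_ne_top β hβ bc j
  have hZpos : 0 < Z.toReal := ENNReal.toReal_pos (partitionFunction_ne_zero β bc j) hZtop
  have hZr : ∫ θ in angleCube bc j, (gibbsWeight β bc j (extendByZero bc j θ)).toReal =
      Z.toReal := by
    rw [hZ, integral_toReal hm.aemeasurable hlt]
  have hint : IntegrableOn (fun θ => (gibbsWeight β bc j (extendByZero bc j θ)).toReal)
      (angleCube bc j) :=
    integrable_toReal_of_lintegral_ne_top hm.aemeasurable (hZ ▸ hZtop)
  have hlaw : ∫ θ, γ.wilson θ ∂(villainLaw β hβ bc j : Measure OneForm) =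
      Z.toReal⁻¹ • ∫ θ : activeEdges bc j → ℝ in angleCube bc j,
        wilsonGibbs β bc j γ (fun e => θ e) := by
    change ∫ θ, γ.wilson θ ∂((Z⁻¹ • unnormalizedLaw β bc j).map (extendByZero bc j)) = _
    rw [integral_map (measurable_extendByZero bc j).aemeasurable hW.aestronglyMeasurable,
      integral_smul_measure, unnormalizedLaw,
      integral_withDensity_eq_integral_toReal_smul hm hlt, ENNReal.toReal_inv]
    simp_rw [wilsonGibbs_ofReal hβ]
  have hshift := setIntegral_pi_Ico_add_I_mul (contDiff_wilsonGibbs hβ bc j γ)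
    (wilsonGibbs_add_two_pi β bc j γ) (fun e => b e)
  have hbound : ‖∫ θ : activeEdges bc j → ℝ in angleCube bc j,
      wilsonGibbs β bc j γ (fun e => θ e)‖ ≤ A * Z.toReal := by
    -- After the shift, the modulus is bounded by `A` times the real Gibbs weight, whose integral is
    -- the partition function.
    rw [angleCube, ← hshift, ← hZr, ← integral_const_mul]
    exact norm_integral_le_of_norm_le (hint.const_mul A)
      (Eventually.of_forall fun θ => norm_wilsonGibbs_le hβ bc j γ b hb θ)
  rw [hlaw, norm_smul, Real.norm_of_nonneg (inv_nonneg.2 hZpos.le), inv_mul_le_iff₀ hZpos, mul_comm]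
  exact hbound

/-! ### Passage to the infinite-volume limit. -/

theorem continuous_wilson (γ : RectangularLoop) : Continuous γ.wilson := by
  unfold RectangularLoop.wilson
  fun_prop

theorem norm_wilson (γ : RectangularLoop) (θ : OneForm) : ‖γ.wilson θ‖ = 1 := by
  rw [wilson_eq_exp, mul_comm, Complex.norm_exp_ofReal_mul_I]

/-- An eventual bound on the finite-volume Wilson loop expectations passes to the limit. -/
theorem norm_integral_wilson_le_of_eventually {β : ℝ} {hβ : 0 < β} {bc : BoundaryCondition}
    {P : ProbabilityMeasure OneForm} (hP : IsInfiniteVolumeLimit β hβ bc P) (γ : RectangularLoop)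
    {A : ℝ} (hA : ∀ᶠ j in atTop,
      ‖∫ θ, γ.wilson θ ∂(villainLaw β hβ bc j : Measure OneForm)‖ ≤ A) :
    ‖∫ θ, γ.wilson θ ∂(P : Measure OneForm)‖ ≤ A := by
  obtain ⟨φ, hφ, hlim⟩ := hP
  let W : BoundedContinuousFunction OneForm ℂ :=
    BoundedContinuousFunction.ofNormedAddCommGroup γ.wilson (continuous_wilson γ) 1
      fun θ => (norm_wilson γ θ).le
  have h := (ProbabilityMeasure.tendsto_iff_forall_integral_rclike_tendsto ℂ).1 hlim W
  exact le_of_tendsto h.norm (hφ.tendsto_atTop.eventually hA)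

/-! ### The logarithmic profile and its planar energy. -/

/-- The truncated logarithmic profile `∑_{r ≤ k < H} 1 / (k + 1)`. -/
noncomputable def logProfile (H r : ℕ) : ℝ := ∑ k ∈ Finset.Ico r H, 1 / ((k : ℝ) + 1)

/-- A bound on the squared increments of `logProfile H` at `n`. -/
noncomputable def logProfileSlope (H n : ℕ) : ℝ := if n ≤ H then 1 / (max (n : ℝ) 1) ^ 2 else 0

theorem logProfile_of_le {H r : ℕ} (h : H ≤ r) : logProfile H r = 0 := by
  simp [logProfile, h]

theorem log_le_logProfile_zero {H : ℕ} (hH : 0 < H) : Real.log H ≤ logProfile H 0 := by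
  have h1 : Real.log H ≤ Real.log ((H + 1 : ℕ) : ℝ) :=
    Real.log_le_log (by exact_mod_cast hH) (by push_cast; linarith)
  refine h1.trans ((log_add_one_le_harmonic H).trans_eq ?_)
  simp [harmonic, logProfile]

/-- Absorbs the contribution of the centre in `sum_planeBall_slope_le`. -/
theorem one_le_logProfile_zero {H : ℕ} (hH : 0 < H) : 1 ≤ logProfile H 0 := by
  have := Finset.single_le_sum (f := fun k : ℕ => 1 / ((k : ℝ) + 1)) (s := Finset.Ico 0 H)
    (fun _ _ => by positivity) (Finset.mem_Ico.2 ⟨le_rfl, hH⟩)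
  simpa [logProfile] using this

theorem logProfileSlope_nonneg (H n : ℕ) : 0 ≤ logProfileSlope H n := by
  unfold logProfileSlope
  split_ifs <;> positivity

theorem logProfile_sub_succ (H n : ℕ) :
    logProfile H n - logProfile H (n + 1) = if n < H then 1 / ((n : ℝ) + 1) else 0 := by
  split_ifs with h
  · rw [logProfile, logProfile, Finset.sum_eq_sum_Ico_succ_bot h]
    ring
  · rw [logProfile_of_le (by omega), logProfile_of_le (by omega), sub_zero]

/-- The inward increment at radius `n` is `1/n` and the outward one `1/(n+1)`. The inward one is
nonzero even at `n = H`, hence `n ≤ H` in the slope; `max n 1` covers the centre. -/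
theorem sq_logProfile_sub_le (H : ℕ) {n m : ℕ} (h1 : n ≤ m + 1) (h2 : m ≤ n + 1) :
    (logProfile H n - logProfile H m) ^ 2 ≤ logProfileSlope H n := by
  rcases (by omega : m = n ∨ m = n + 1 ∨ n = m + 1) with rfl | rfl | rfl
  · simpa using logProfileSlope_nonneg H m
  · rw [logProfile_sub_succ, logProfileSlope]
    by_cases h : n < H
    · rw [if_pos h, if_pos h.le, div_pow, one_pow]
      gcongr
      exact max_le (by linarith) (by linarith [(Nat.cast_nonneg n : (0 : ℝ) ≤ n)])
    · rw [if_neg h, zero_pow two_ne_zero]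
      split_ifs <;> positivity
  · rw [← neg_sub, neg_sq, logProfile_sub_succ, logProfileSlope]
    by_cases h : m < H
    · rw [if_pos h, if_pos (by omega), div_pow, one_pow]
      gcongr
      push_cast
      exact max_le le_rfl (by linarith [(Nat.cast_nonneg m : (0 : ℝ) ≤ m)])
    · rw [if_neg h, zero_pow two_ne_zero]
      split_ifs <;> positivity

/-- The sup-norm ball of radius `H` in `ℤ²`. -/
noncomputable def planeBall (H : ℕ) : Finset (ℤ × ℤ) := (Finset.range (H + 1)).biUnion Finset.box

theorem mem_planeBall {H : ℕ} {v : ℤ × ℤ} :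
    v ∈ planeBall H ↔ max v.1.natAbs v.2.natAbs ≤ H := by
  simp only [planeBall, Finset.mem_biUnion, Finset.mem_range, Int.mem_box]
  constructor
  · rintro ⟨n, hn, h⟩; omega
  · intro h; exact ⟨_, by omega, rfl⟩

/-- The sup-norm sphere of radius `n ≥ 1` has `8n` points, each contributing `1/n²`: eight harmonic
sums, plus `1` for the centre. -/
theorem sum_planeBall_slope_le {H : ℕ} (hH : 0 < H) :
    ∑ v ∈ planeBall H, logProfileSlope H (max v.1.natAbs v.2.natAbs) ≤ 9 * logProfile H 0 := by
  have hd : Set.PairwiseDisjoint (↑(Finset.range (H + 1)))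
      (Finset.box : ℕ → Finset (ℤ × ℤ)) := by
    intro a _ b _ hab
    refine Finset.disjoint_left.2 fun v hv hv' => hab ?_
    rw [Int.mem_box] at hv hv'
    omega
  rw [planeBall, Finset.sum_biUnion hd, Finset.sum_range_succ']
  have h0 : ∑ v ∈ (Finset.box 0 : Finset (ℤ × ℤ)),
      logProfileSlope H (max v.1.natAbs v.2.natAbs) = 1 := by
    simp [logProfileSlope]
  have hs : ∀ n ∈ Finset.range H, ∑ v ∈ (Finset.box (n + 1) : Finset (ℤ × ℤ)),
      logProfileSlope H (max v.1.natAbs v.2.natAbs) = 8 * (1 / ((n : ℝ) + 1)) := by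
    intro n hn
    have hn' := Finset.mem_range.1 hn
    have : ∀ v ∈ (Finset.box (n + 1) : Finset (ℤ × ℤ)),
        logProfileSlope H (max v.1.natAbs v.2.natAbs) = 1 / ((n : ℝ) + 1) ^ 2 := by
      intro v hv
      rw [Int.mem_box] at hv
      rw [hv, logProfileSlope, if_pos (by omega), max_eq_left]
      · push_cast; rfl
      · push_cast; linarith [(Nat.cast_nonneg n : (0 : ℝ) ≤ n)]
    rw [Finset.sum_congr rfl this, Finset.sum_const, Int.card_box (by omega), nsmul_eq_mul]
    push_cast
    field_simp
  rw [h0, Finset.sum_congr rfl hs, ← Finset.mul_sum]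
  have h1 : ∑ n ∈ Finset.range H, 1 / ((n : ℝ) + 1) = logProfile H 0 := by
    rw [logProfile, Finset.range_eq_Ico]
  rw [h1]
  linarith [one_le_logProfile_zero hH]

/-! ### The wire form and its energy. -/

/-- The sup-norm distance of `y` to the line through the origin in direction `d`. -/
def axisDist (d : Fin 3) (y : Site) : ℕ := max (y (d + 1)).natAbs (y (d + 2)).natAbs

theorem axisDist_add_unitVec (d k : Fin 3) (y : Site) :
    axisDist d (y + unitVec k) ≤ axisDist d y + 1 ∧
      axisDist d y ≤ axisDist d (y + unitVec k) + 1 := by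
  simp only [axisDist, unitVec, Pi.add_apply, Pi.single_apply]
  split_ifs <;> omega

/-- The one-form pointing in direction `d`, supported around the segment of length `L` that starts
at `x₀` in direction `d`, and with a truncated logarithmic profile in the transverse directions. -/
noncomputable def wireForm (d : Fin 3) (x₀ : Site) (L H : ℕ) : OneForm := fun e =>
  if e.2 = d ∧ 0 ≤ (e.1 - x₀) d ∧ (e.1 - x₀) d < L then logProfile H (axisDist d (e.1 - x₀)) else 0

/-- The site-wise bound on the squared exterior derivative of `wireForm`. -/
noncomputable def wireSlope (L H : ℕ) (v : ℤ × ℤ × ℤ) : ℝ :=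
  if 0 ≤ v.1 ∧ v.1 < L then logProfileSlope H (max v.2.1.natAbs v.2.2.natAbs) else 0

theorem wireSlope_nonneg (L H : ℕ) (v : ℤ × ℤ × ℤ) : 0 ≤ wireSlope L H v := by
  unfold wireSlope
  split_ifs
  exacts [logProfileSlope_nonneg _ _, le_rfl]

/-- Coordinates along and transverse to the direction `d`. -/
def axisCoord (d : Fin 3) (y : Site) : ℤ × ℤ × ℤ := (y d, y (d + 1), y (d + 2))

theorem axisCoord_injective (d : Fin 3) : Function.Injective (axisCoord d) := by
  intro y z h
  simp only [axisCoord, Prod.mk.injEq] at h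
  funext k
  fin_cases d <;> fin_cases k <;> simp_all

/-- A step in a transverse direction preserves the coordinate along `d`, so the abrupt cut at the
ends of the segment costs nothing. -/
theorem sq_wireForm_sub_le (d k : Fin 3) (hk : k ≠ d) (x₀ : Site) (L H : ℕ) (x : Site) :
    (wireForm d x₀ L H (x, d) - wireForm d x₀ L H (x + unitVec k, d)) ^ 2 ≤
      wireSlope L H (axisCoord d (x - x₀)) := by
  have h : (x + unitVec k - x₀) d = (x - x₀) d := by simp [unitVec, hk.symm]
  have h' : x + unitVec k - x₀ = x - x₀ + unitVec k := by abel
  by_cases hx : 0 ≤ (x - x₀) d ∧ (x - x₀) d < L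
  · obtain ⟨h1, h2⟩ := axisDist_add_unitVec d k (x - x₀)
    simp only [wireForm, wireSlope, axisCoord, h, hx, and_self, if_true, h']
    exact sq_logProfile_sub_le H h2 h1
  · simp only [wireForm, h, hx, and_false, if_false, sub_zero, ne_eq, OfNat.ofNat_ne_zero,
      not_false_eq_true, zero_pow]
    exact wireSlope_nonneg _ _ _

/-- On a face only the two parallel edges in direction `d`, if any, contribute. -/
theorem sq_faceDeriv_wireForm_le (d : Fin 3) (x₀ : Site) (L H : ℕ) (f : Face)
    (hf : f.2.1 ≠ f.2.2) :
    faceDeriv (wireForm d x₀ L H) f ^ 2 ≤ wireSlope L H (axisCoord d (f.1 - x₀)) := by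
  obtain ⟨x, i, k⟩ := f
  simp only at hf ⊢
  have hz : ∀ y, ∀ l ≠ d, wireForm d x₀ L H (y, l) = 0 := fun y l hl => by simp [wireForm, hl]
  by_cases hi : i = d
  · subst hi
    simpa [faceDeriv, hz _ k hf.symm] using sq_wireForm_sub_le i k hf.symm x₀ L H x
  by_cases hk : k = d
  · subst hk
    rw [← neg_sq]
    simpa [faceDeriv, hz _ i hf] using sq_wireForm_sub_le k i hf x₀ L H x
  · simpa [faceDeriv, hz _ i hi, hz _ k hk] using wireSlope_nonneg _ _ _

/-- In the coordinates `axisCoord d` the sum splits into at most `L` slices, each bounded by the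
planar energy. -/
theorem sum_wireSlope_le (d : Fin 3) (x₀ : Site) (L : ℕ) {H : ℕ} (hH : 0 < H) (s : Finset Site) :
    ∑ x ∈ s, wireSlope L H (axisCoord d (x - x₀)) ≤ 9 * (L * logProfile H 0) := by
  classical
  have hinj : Function.Injective fun x => axisCoord d (x - x₀) :=
    (axisCoord_injective d).comp sub_left_injective
  let t : Finset (ℤ × ℤ × ℤ) := Finset.Ico (0 : ℤ) L ×ˢ planeBall H
  calc ∑ x ∈ s, wireSlope L H (axisCoord d (x - x₀))
      = ∑ v ∈ s.image (fun x => axisCoord d (x - x₀)), wireSlope L H v :=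
        (Finset.sum_image hinj.injOn).symm
    _ = ∑ v ∈ (s.image (fun x => axisCoord d (x - x₀))).filter (· ∈ t), wireSlope L H v := by
        refine (Finset.sum_filter_of_ne fun v _ hv => ?_).symm
        simp only [wireSlope, logProfileSlope] at hv
        split_ifs at hv with h1 h2
        · exact Finset.mem_product.2 ⟨Finset.mem_Ico.2 h1, mem_planeBall.2 h2⟩
        · exact absurd rfl hv
        · exact absurd rfl hv
    _ ≤ ∑ v ∈ t, wireSlope L H v :=
        Finset.sum_le_sum_of_subset_of_nonneg (fun v hv => (Finset.mem_filter.1 hv).2)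
          fun v _ _ => wireSlope_nonneg L H v
    _ = ∑ a ∈ Finset.Ico (0 : ℤ) L, ∑ v ∈ planeBall H,
          logProfileSlope H (max v.1.natAbs v.2.natAbs) := by
        rw [Finset.sum_product]
        refine Finset.sum_congr rfl fun a ha => Finset.sum_congr rfl fun v _ => ?_
        rw [wireSlope, if_pos (Finset.mem_Ico.1 ha)]
    _ ≤ 9 * (L * logProfile H 0) := by
        rw [Finset.sum_const, Int.card_Ico, nsmul_eq_mul]
        simp only [sub_zero, Int.toNat_natCast]
        nlinarith [sum_planeBall_slope_le hH, (Nat.cast_nonneg L : (0 : ℝ) ≤ L)]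

/-- `81 = 9 · 9`: the planar constant times the nine pairs of directions at a site, a crude count of
its faces. -/
theorem sum_sq_faceDeriv_wireForm_le (d : Fin 3) (x₀ : Site) (L : ℕ) {H : ℕ} (hH : 0 < H)
    (bc : BoundaryCondition) (j : ℕ) :
    ∑ f ∈ activeFaces bc j, faceDeriv (wireForm d x₀ L H) f ^ 2 ≤ 81 * (L * logProfile H 0) := by
  classical
  calc ∑ f ∈ activeFaces bc j, faceDeriv (wireForm d x₀ L H) f ^ 2
      ≤ ∑ f ∈ activeFaces bc j, wireSlope L H (axisCoord d (f.1 - x₀)) :=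
        Finset.sum_le_sum fun f hf =>
          sq_faceDeriv_wireForm_le d x₀ L H f (Finset.mem_filter.1 hf).2.1.ne
    _ ≤ ∑ f ∈ boxSites j ×ˢ (Finset.univ : Finset (Fin 3 × Fin 3)),
          wireSlope L H (axisCoord d (f.1 - x₀)) :=
        Finset.sum_le_sum_of_subset_of_nonneg
          (fun f hf => by
            have := (Finset.mem_product.1 (Finset.mem_filter.1 hf).1).1
            simp [this])
          fun f _ _ => wireSlope_nonneg _ _ _
    _ = 9 * ∑ x ∈ boxSites j, wireSlope L H (axisCoord d (x - x₀)) := by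
        rw [Finset.sum_product, Finset.mul_sum]
        simp
    _ ≤ 81 * (L * logProfile H 0) := by linarith [sum_wireSlope_le d x₀ L hH (boxSites j)]

/-! ### Support and circulation of the wire form. -/

/-- An edge based at an interior vertex is active under both boundary conditions, which are treated
together from here on. -/
theorem mem_activeEdges_of_abs_lt (bc : BoundaryCondition) {j : ℕ} {e : Edge}
    (h : ∀ k, |e.1 k| < j) : e ∈ activeEdges bc j := by
  have hbox : CellInBox j e.1 {e.2} := fun k => by
    have := abs_lt.1 (h k)
    split_ifs <;> omega
  classical
  refine Finset.mem_filter.2 ⟨Finset.mem_product.2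
    ⟨Fintype.mem_piFinset.2 fun k => Finset.mem_Icc.2 ?_, Finset.mem_univ _⟩, ?_⟩
  · have := abs_lt.1 (h k)
    omega
  · cases bc
    · exact hbox
    · exact ⟨hbox, fun ⟨k, _, hk⟩ => (h k).ne hk⟩

theorem eventually_wireForm_active (d : Fin 3) (x₀ : Site) (L H : ℕ) (bc : BoundaryCondition) :
    ∀ᶠ j in atTop, ∀ e, wireForm d x₀ L H e ≠ 0 → e ∈ activeEdges bc j := by
  filter_upwards [eventually_ge_atTop
    ((x₀ 0).natAbs + (x₀ 1).natAbs + (x₀ 2).natAbs + L + H)] with j hj e he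
  simp only [wireForm, ne_eq, ite_eq_right_iff, Classical.not_imp] at he
  obtain ⟨⟨-, h1, h2⟩, h3⟩ := he
  have h4 : axisDist d (e.1 - x₀) < H := by
    by_contra h
    exact h3 (logProfile_of_le (not_lt.1 h))
  refine mem_activeEdges_of_abs_lt bc fun k => ?_
  rw [abs_lt]
  fin_cases d <;> fin_cases k <;> simp [axisDist] at h1 h2 h4 ⊢ <;> omega

theorem wireForm_of_ne {d k : Fin 3} (h : k ≠ d) (x₀ x : Site) (L H : ℕ) :
    wireForm d x₀ L H (x, k) = 0 := by
  simp [wireForm, h]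

theorem wireForm_wire (d : Fin 3) (x₀ : Site) {L s : ℕ} (hs : s < L) (H : ℕ) :
    wireForm d x₀ L H (x₀ + s • unitVec d, d) = logProfile H 0 := by
  have h1 : axisDist d (s • unitVec d) = 0 := by
    fin_cases d <;> simp [axisDist, unitVec]
  have h2 : (s • unitVec d) d = s := by simp [unitVec]
  simp only [wireForm, add_sub_cancel_left, h1, h2, true_and]
  exact if_pos ⟨by positivity, by exact_mod_cast hs⟩

/-- The opposite side lies at distance `H`, where the truncated profile has just vanished, so it
cancels none of the circulation. -/
theorem wireForm_opposite {d k : Fin 3} (h : k ≠ d) (x₀ : Site) (L H s : ℕ) :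
    wireForm d x₀ L H (x₀ + H • unitVec k + s • unitVec d, d) = 0 := by
  have hd : H ≤ axisDist d (H • unitVec k + s • unitVec d) := by
    fin_cases d <;> fin_cases k <;> simp [axisDist, unitVec] at h ⊢
  rw [wireForm, add_assoc, add_sub_cancel_left, logProfile_of_le hd, ite_self]

theorem circulation_wireForm_dir₁ (γ : RectangularLoop) :
    γ.circulation (wireForm γ.dir₁ γ.base γ.len₁ γ.len₂) = γ.len₁ * logProfile γ.len₂ 0 := by
  simp only [RectangularLoop.circulation, wireForm_of_ne γ.dir_ne.symm,
    wireForm_opposite γ.dir_ne.symm]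
  rw [Finset.sum_congr rfl fun s hs =>
    wireForm_wire γ.dir₁ γ.base (Finset.mem_range.1 hs) γ.len₂]
  simp

/-- The sign appears because the loop runs backwards along its `dir₂` side through `base`. -/
theorem circulation_wireForm_dir₂ (γ : RectangularLoop) :
    γ.circulation (wireForm γ.dir₂ γ.base γ.len₂ γ.len₁) = -(γ.len₂ * logProfile γ.len₁ 0) := by
  simp only [RectangularLoop.circulation, wireForm_of_ne γ.dir_ne, wireForm_opposite γ.dir_ne]
  rw [Finset.sum_congr rfl fun s hs =>
    wireForm_wire γ.dir₂ γ.base (Finset.mem_range.1 hs) γ.len₁]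
  simp

/-- Every rectangular loop has a wire form with large circulation around it. -/
theorem exists_wireForm (γ : RectangularLoop) : ∃ (d : Fin 3) (ε : ℝ), ε ^ 2 = 1 ∧
    ε * γ.circulation (wireForm d γ.base γ.longSide γ.shortSide) =
      γ.longSide * logProfile γ.shortSide 0 := by
  rcases le_total γ.len₂ γ.len₁ with h | h
  · refine ⟨γ.dir₁, 1, by norm_num, ?_⟩
    rw [RectangularLoop.longSide, RectangularLoop.shortSide, max_eq_left h, min_eq_right h,
      circulation_wireForm_dir₁, one_mul]
  · refine ⟨γ.dir₂, -1, by norm_num, ?_⟩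
    rw [RectangularLoop.longSide, RectangularLoop.shortSide, max_eq_right h, min_eq_left h,
      circulation_wireForm_dir₂]
    ring

/-! ### Optimisation of the amplitude. -/

theorem eventually_norm_integral_wilson_le {β : ℝ} (hβ : 0 < β) (bc : BoundaryCondition)
    (γ : RectangularLoop) : ∀ᶠ j in atTop,
      ‖∫ θ, γ.wilson θ ∂(villainLaw β hβ bc j : Measure OneForm)‖ ≤
        Real.exp (-((1 / 81) / (2 * β)) * (γ.longSide : ℝ) * Real.log (γ.shortSide : ℝ)) := by
  obtain ⟨d, ε, hε, hcirc⟩ := exists_wireForm γ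
  have hH : 0 < γ.shortSide := lt_min γ.len₁_pos γ.len₂_pos
  filter_upwards [eventually_wireForm_active d γ.base γ.longSide γ.shortSide bc] with j hj
  set w := wireForm d γ.base γ.longSide γ.shortSide
  -- With `X = L h`, the amplitude `t = 1/(81β)` minimises `-t X + (β/2) t² · 81 X`, with value
  -- `-X/(162β)`; this is where `C = 1/81` comes from. The sign `ε` makes the circulation positive
  -- and drops out of the energy.
  set c : ℝ := ε / (81 * β)
  -- The summand `0` gives `b` the shape required by `circulation_add_mul`.
  let b : OneForm := fun e => 0 + c * w e
  have hb : ∀ e, b e ≠ 0 → e ∈ activeEdges bc j := fun e he => hj e fun h => he (by simp [b, h])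
  have hcb : γ.circulation b = γ.longSide * logProfile γ.shortSide 0 / (81 * β) := by
    have : γ.circulation (fun _ => (0 : ℝ)) = 0 := by simp [RectangularLoop.circulation]
    rw [circulation_add_mul, this, ← hcirc]
    ring
  have hE : ∑ f ∈ activeFaces bc j, faceDeriv b f ^ 2 =
      1 / (81 * β) ^ 2 * ∑ f ∈ activeFaces bc j, faceDeriv w f ^ 2 := by
    rw [Finset.mul_sum]
    refine Finset.sum_congr rfl fun f _ => ?_
    have : faceDeriv b f = c * faceDeriv w f := by
      simp only [b, faceDeriv]; ring
    rw [this, mul_pow, div_pow, hε]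
  refine (norm_integral_wilson_villainLaw_le hβ bc j γ b hb).trans (Real.exp_le_exp.2 ?_)
  have h1 := sum_sq_faceDeriv_wireForm_le d γ.base γ.longSide hH bc j
  rw [hcb, hE]
  calc _ ≤ -(γ.longSide * logProfile γ.shortSide 0 / (81 * β)) + β / 2 * (1 / (81 * β) ^ 2 *
        (81 * (γ.longSide * logProfile γ.shortSide 0))) := by gcongr
    _ = -((1 / 81) / (2 * β)) * γ.longSide * logProfile γ.shortSide 0 := by
        field_simp
        ring
    _ ≤ _ := by
        have h2 : 0 ≤ (1 / 81) / (2 * β) * (γ.longSide : ℝ) := by positivity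
        have := mul_le_mul_of_nonneg_left (log_le_logProfile_zero hH) h2
        linarith

end VillainU1

theorem corollaryc :
    ∃ C : ℝ, 0 < C ∧
      ∀ (β : ℝ) (hβ : 0 < β) (bc : VillainU1.BoundaryCondition)
        (P : MeasureTheory.ProbabilityMeasure VillainU1.OneForm),
        VillainU1.IsInfiniteVolumeLimit β hβ bc P →
        ∀ γ : VillainU1.RectangularLoop,
          ‖∫ θ, γ.wilson θ ∂(P : MeasureTheory.Measure VillainU1.OneForm)‖ ≤
            Real.exp (-(C / (2 * β)) * (γ.longSide : ℝ) * Real.log (γ.shortSide : ℝ)) :=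
  ⟨1 / 81, by norm_num, fun _ hβ bc _ hP γ =>
    VillainU1.norm_integral_wilson_le_of_eventually hP γ
      (VillainU1.eventually_norm_integral_wilson_le hβ bc γ)⟩
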